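/- Let $m\ge 0$ be an integer, let $A^{(0)},\dots,A^{(m)}$ and $B^{(0)},\dots,B^{(m)}$ be complex $d\times d$ matrices and let $C^{(0)},\dots,C^{(m)}$ be complex $c\times c$ matrices. Suppose that the $dc\times dc$ matrices $A_i = A^{(i)}\otimes C^{(i)}$ and $B_i = B^{(i)}\otimes C^{(i)}$ (Kronecker products) are positive semidefinite for all $i=0,\dots,m$ (for example because all the factors are positive semidefinite), that $A_i$ and $B_i$ have full rank for all $i\ge 1$, and that $C^{(0)}\neq 0$. If there is a single unitary $dc\times dc$ matrix $U$ with $U A_i U^\dagger = B_i$ for all $i=0,\dots,m$, then there is a single unitary $d\times d$ matrix $V$ with $V A^{(i)} V^\dagger = B^{(i)}$ for all $i=0,\dots,m$. -/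

import Mathlib

open scoped Kronecker Matrix ComplexOrder

namespace Matrix

/-! ### Polynomial functional calculus and the polar part. -/

section FunctionalCalculus

variable {n : Type*} [Fintype n] [DecidableEq n]

/-! Logarithms turn the tensor product into a sum. After rescaling by traces
(`exists_posSemidef_factors`) all factors are positive semidefinite, and log (A ⊗ C) = log A ⊗ Q + P
⊗ log C, where P and Q are the support projections of A and C and log 0 = 0. Conjugation by U
carries these logarithms, and the supports P ⊗ Q, from the A side to the B side, so traces of words
in them agree.

Expanding a word gives the word in log A and P, tensored with a word in the Q's, plus terms with
fewer logarithms of A. Since the C side is common to both families, induction on that number cancels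
the lower terms (`trace_word_cancel`). The trace of the Q-word can be divided out because only one Q
differs from 1, and it is a nonzero projection.

Hence all word traces in log A, P match those in log B, P'. Specht's theorem
(`exists_unitary_conj_of_trace_eq`) yields V, and A = P exp (log A) transfers the conjugation back
to A. -/

lemma mul_aeval_of_intertwine {S M N : Matrix n n ℂ} (h : S * M = N * S) (p : Polynomial ℂ) :
    S * Polynomial.aeval M p = Polynomial.aeval N p * S := by
  induction p using Polynomial.induction_on' with
  | add p q hp hq => simp [mul_add, add_mul, hp, hq]
  | monomial k a =>
    have hk : S * M ^ k = N ^ k * S := by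
      induction k with
      | zero => simp
      | succ k ih => rw [pow_succ, ← mul_assoc, ih, mul_assoc, h, ← mul_assoc, ← pow_succ]
    simp only [Polynomial.aeval_monomial, Algebra.algebraMap_eq_smul_one, smul_mul_assoc, one_mul,
      mul_smul_comm, hk]

lemma aeval_unitary_conj {U : Matrix n n ℂ} (hU : U ∈ unitaryGroup n ℂ) (M : Matrix n n ℂ)
    (p : Polynomial ℂ) :
    Polynomial.aeval (U * M * Uᴴ) p = U * Polynomial.aeval M p * Uᴴ := by
  have h1 : Uᴴ * U = 1 := mem_unitaryGroup_iff'.mp hU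
  have h2 : U * Uᴴ = 1 := mem_unitaryGroup_iff.mp hU
  have h : U * M = (U * M * Uᴴ) * U := by rw [mul_assoc _ Uᴴ, h1, mul_one]
  rw [mul_aeval_of_intertwine h, mul_assoc (Polynomial.aeval _ p), h2, mul_one]

lemma aeval_diagonal (d : n → ℂ) (p : Polynomial ℂ) :
    Polynomial.aeval (diagonal d) p = diagonal fun i => p.eval (d i) := by
  have := Polynomial.aeval_algHom_apply (diagonalAlgHom (n := n) (α := ℂ) ℂ) d p
  simp only [diagonalAlgHom_apply] at this
  rw [this]
  congr 1
  ext i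
  simp [Polynomial.aeval_pi]

lemma exists_polynomial_eval_eq (s : Finset ℂ) (g : ℂ → ℂ) :
    ∃ p : Polynomial ℂ, ∀ x ∈ s, p.eval x = g x :=
  ⟨Lagrange.interpolate s id g, fun _ hx =>
    Lagrange.eval_interpolate_at_node g (Set.injOn_id _) hx⟩

lemma IsHermitian.exists_unitary_diagonal {M : Matrix n n ℂ} (hM : M.IsHermitian) :
    ∃ U ∈ unitaryGroup n ℂ, M = U * diagonal (fun i => (hM.eigenvalues i : ℂ)) * Uᴴ :=
  ⟨hM.eigenvectorUnitary, hM.eigenvectorUnitary.2, hM.spectral_theorem⟩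

lemma unitary_conj_mul {U : Matrix n n ℂ} (hU : U ∈ unitaryGroup n ℂ) (M N : Matrix n n ℂ) :
    U * M * Uᴴ * (U * N * Uᴴ) = U * (M * N) * Uᴴ := by
  have h1 : Uᴴ * U = 1 := mem_unitaryGroup_iff'.mp hU
  calc _ = U * M * (Uᴴ * U) * N * Uᴴ := by simp only [mul_assoc]
    _ = _ := by rw [h1]; simp only [mul_assoc, one_mul]

/-- The inverse square root of `Sᴴ * S` on its support, as a polynomial in `Sᴴ * S`. -/
lemma exists_polynomial_partial_inv_sqrt (S : Matrix n n ℂ) :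
    ∃ p : Polynomial ℂ,
      S * Polynomial.aeval (Sᴴ * S) p * (S * Polynomial.aeval (Sᴴ * S) p)ᴴ *
        (S * Polynomial.aeval (Sᴴ * S) p) = S * Polynomial.aeval (Sᴴ * S) p ∧
      (S * Polynomial.aeval (Sᴴ * S) p = 0 → S = 0) := by
  have hpos := posSemidef_conjTranspose_mul_self S
  have hH := hpos.isHermitian
  obtain ⟨U, hU, hM⟩ := hH.exists_unitary_diagonal
  set l := hH.eigenvalues with hl
  have hl0 : ∀ i, 0 ≤ l i := hpos.eigenvalues_nonneg
  -- Since 0⁻¹ = 0, this p vanishes at the eigenvalue 0, so the polar part is a partial isometry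
  -- supported off the kernel of S.
  obtain ⟨p, hp⟩ := exists_polynomial_eval_eq (Finset.univ.image fun i => (l i : ℂ))
    fun x => (((Real.sqrt x.re)⁻¹ : ℝ) : ℂ)
  have hp' : ∀ i, p.eval (l i : ℂ) = (((Real.sqrt (l i))⁻¹ : ℝ) : ℂ) := fun i => by
    simpa using hp (l i) (by simp)
  set H := Sᴴ * S with hHdef
  have hQ : Polynomial.aeval H p = U * diagonal (fun i => (((Real.sqrt (l i))⁻¹ : ℝ) : ℂ)) * Uᴴ := by
    rw [hM, aeval_unitary_conj hU, aeval_diagonal]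
    simp only [hp']
  have hQh : (Polynomial.aeval H p).IsHermitian := by
    rw [hQ]
    refine isHermitian_mul_mul_conjTranspose _ ?_
    rw [isHermitian_diagonal_iff]
    intro i
    simp [IsSelfAdjoint]
  have key1 : Polynomial.aeval H p * Polynomial.aeval H p * H * Polynomial.aeval H p
      = Polynomial.aeval H p := by
    rw [hQ]
    nth_rewrite 1 [hM]
    simp only [unitary_conj_mul hU, diagonal_mul_diagonal]
    congr 3
    ext i
    rw [← Complex.ofReal_mul, ← Complex.ofReal_mul, ← Complex.ofReal_mul]
    congr 1
    rcases (hl0 i).eq_or_lt with h | h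
    · simp [← h]
    · have hs0 : Real.sqrt (l i) ≠ 0 := (Real.sqrt_pos.mpr h).ne'
      have hs := Real.mul_self_sqrt (hl0 i)
      generalize Real.sqrt (l i) = s at hs hs0
      rw [← hs]
      field_simp
  have key2 : H * (Polynomial.aeval H p * Polynomial.aeval H p) * H = H := by
    rw [hQ]
    nth_rewrite 1 2 3 [hM]
    simp only [unitary_conj_mul hU, diagonal_mul_diagonal]
    congr 3
    ext i
    rw [← Complex.ofReal_mul, ← Complex.ofReal_mul, ← Complex.ofReal_mul]
    congr 1
    rcases (hl0 i).eq_or_lt with h | h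
    · simp [← h]
    · have hs0 : Real.sqrt (l i) ≠ 0 := (Real.sqrt_pos.mpr h).ne'
      have hs := Real.mul_self_sqrt (hl0 i)
      generalize Real.sqrt (l i) = s at hs hs0
      rw [← hs]
      field_simp
  refine ⟨p, ?_, ?_⟩
  · rw [conjTranspose_mul, hQh.eq]
    calc _ = S * (Polynomial.aeval H p * Polynomial.aeval H p * (Sᴴ * S) * Polynomial.aeval H p) := by
          simp only [mul_assoc]
      _ = _ := by rw [← hHdef, key1]
  · intro h
    have : Sᴴ * S = 0 := by
      rw [← hHdef, ← key2]
      calc _ = Sᴴ * (S * Polynomial.aeval H p) * Polynomial.aeval H p * H := by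
            nth_rewrite 1 [hHdef]; simp only [mul_assoc]
        _ = 0 := by simp [h]
    exact conjTranspose_mul_self_eq_zero.mp this

end FunctionalCalculus

end Matrix

namespace Matrix

/-! ### Specht's theorem. -/

section Specht

variable {n : Type*} [Fintype n] [DecidableEq n] {J : Type*} {X Y : J → Matrix n n ℂ}

/-- The orthogonal complement for the Frobenius inner product. The trace description shows that
Hermitian left multiplications preserving K also preserve the complement. -/
lemma isCompl_trace_orthogonal (K : Submodule ℂ (Matrix n n ℂ)) :
    ∃ K' : Submodule ℂ (Matrix n n ℂ), IsCompl K K' ∧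
      ∀ m, m ∈ K' ↔ ∀ b ∈ K, (bᴴ * m).trace = 0 := by
  let _ : NormedAddCommGroup (Matrix n n ℂ) := toMatrixNormedAddCommGroup 1 PosDef.one
  let _ : InnerProductSpace ℂ (Matrix n n ℂ) := toMatrixInnerProductSpace 1 PosSemidef.one
  refine ⟨Kᗮ, Submodule.isCompl_orthogonal _, fun m => ?_⟩
  rw [Submodule.mem_orthogonal]
  refine forall₂_congr fun b _ => ?_
  have : inner ℂ b m = (m * 1 * bᴴ).trace := rfl
  rw [this, mul_one, trace_mul_comm]

lemma exists_lift_eq_conjTranspose (hX : ∀ j, (X j).IsHermitian) (hY : ∀ j, (Y j).IsHermitian)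
    (r : FreeAlgebra ℂ J) :
    ∃ r', FreeAlgebra.lift ℂ X r' = (FreeAlgebra.lift ℂ X r)ᴴ ∧
      FreeAlgebra.lift ℂ Y r' = (FreeAlgebra.lift ℂ Y r)ᴴ := by
  induction r using FreeAlgebra.induction with
  | grade0 z =>
    exact ⟨algebraMap ℂ _ (star z), by
      simp [Algebra.algebraMap_eq_smul_one, conjTranspose_smul]⟩
  | grade1 j => exact ⟨FreeAlgebra.ι ℂ j, by simp [(hX j).eq, (hY j).eq]⟩
  | mul a b ha hb =>
    obtain ⟨a', h1, h2⟩ := ha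
    obtain ⟨b', h3, h4⟩ := hb
    exact ⟨b' * a', by simp [h1, h2, h3, h4, conjTranspose_mul]⟩
  | add a b ha hb =>
    obtain ⟨a', h1, h2⟩ := ha
    obtain ⟨b', h3, h4⟩ := hb
    exact ⟨a' + b', by simp [h1, h2, h3, h4, conjTranspose_add]⟩

lemma lift_intertwine {S : Matrix n n ℂ} (h : ∀ j, S * X j = Y j * S) (r : FreeAlgebra ℂ J) :
    S * FreeAlgebra.lift ℂ X r = FreeAlgebra.lift ℂ Y r * S := by
  induction r using FreeAlgebra.induction with
  | grade0 z => simp [Algebra.algebraMap_eq_smul_one]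
  | grade1 j => simp [h]
  | mul a b ha hb => rw [map_mul, map_mul, ← mul_assoc, ha, mul_assoc, hb, mul_assoc]
  | add a b ha hb => simp [mul_add, add_mul, ha, hb]

lemma trace_lift_eq (h : ∀ w : List J, (w.map X).prod.trace = (w.map Y).prod.trace)
    (r : FreeAlgebra ℂ J) :
    (FreeAlgebra.lift ℂ X r).trace = (FreeAlgebra.lift ℂ Y r).trace := by
  -- Traces are not multiplicative, so the induction on r carries a word on the left and an
  -- arbitrary s on the right.
  suffices H : ∀ s : FreeAlgebra ℂ J,
      (∀ w : List J, ((w.map X).prod * FreeAlgebra.lift ℂ X s).trace =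
        ((w.map Y).prod * FreeAlgebra.lift ℂ Y s).trace) →
      ∀ w : List J, ((w.map X).prod * FreeAlgebra.lift ℂ X (r * s)).trace =
        ((w.map Y).prod * FreeAlgebra.lift ℂ Y (r * s)).trace by
    simpa using H 1 (by simpa using h) []
  induction r using FreeAlgebra.induction with
  | grade0 z =>
    intro s hs w
    simp [Algebra.algebraMap_eq_smul_one, hs]
  | grade1 j =>
    intro s hs w
    simpa [mul_assoc] using hs (w ++ [j])
  | mul a b ha hb =>
    intro s hs
    simpa only [mul_assoc] using ha _ (hb s hs)
  | add a b ha hb =>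
    intro s hs w
    simp only [add_mul, map_add, mul_add, trace_add, ha s hs w, hb s hs w]

/-- A linear map of matrices commuting with left multiplications gives intertwiners. -/
lemma exists_intertwiner_of_linearMap (Φ : Matrix n n ℂ →ₗ[ℂ] Matrix n n ℂ)
    (h : ∀ j m, Φ (X j * m) = Y j * Φ m) (l l' : n) :
    ∃ T : Matrix n n ℂ, (∀ j, T * X j = Y j * T) ∧
      ∀ v, T *ᵥ v = (Φ (vecMulVec v (Pi.single l 1))) *ᵥ Pi.single l' 1 := by
  let F : (n → ℂ) →ₗ[ℂ] (n → ℂ) :=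
    { toFun := fun v => (Φ (vecMulVec v (Pi.single l 1))) *ᵥ Pi.single l' 1
      map_add' := fun v w => by rw [add_vecMulVec, map_add, add_mulVec]
      map_smul' := fun c v => by rw [smul_vecMulVec, map_smul, smul_mulVec]; rfl }
  have hF : ∀ v, (LinearMap.toMatrix' F) *ᵥ v =
      (Φ (vecMulVec v (Pi.single l 1))) *ᵥ Pi.single l' 1 := fun v => by
    rw [LinearMap.toMatrix'_mulVec]; rfl
  refine ⟨LinearMap.toMatrix' F, fun j => ?_, hF⟩
  refine ext_of_mulVec_single fun i => ?_
  rw [← mulVec_mulVec, ← mulVec_mulVec, hF, hF, ← mul_vecMulVec, h, mulVec_mulVec]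

lemma sum_vecMulVec_mulVec_single (M : Matrix n n ℂ) :
    M = ∑ l, vecMulVec (M *ᵥ Pi.single l 1) (Pi.single l 1) := by
  ext i j
  simp [sum_apply, vecMulVec_apply, Pi.single_apply]

/-- A GNS-type argument: X(r)e ↦ Y(r)f is well defined because the trace identity at r*r makes the
Frobenius norms of the two sides equal. The map is extended by zero on the orthogonal complement,
which left multiplication by the Hermitian X j preserves. -/
lemma exists_linearMap_of_trace_eq (hX : ∀ j, (X j).IsHermitian) (hY : ∀ j, (Y j).IsHermitian)
    {e f : Matrix n n ℂ} (hf : f.IsHermitian) (hff : f * f = f)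
    (htr : ∀ r : FreeAlgebra ℂ J,
      (FreeAlgebra.lift ℂ X r * e).trace = (FreeAlgebra.lift ℂ Y r * f).trace) :
    ∃ Φ : Matrix n n ℂ →ₗ[ℂ] Matrix n n ℂ, Φ e = f ∧ (∀ j m, Φ (X j * m) = Y j * Φ m) := by
  let α : FreeAlgebra ℂ J →ₗ[ℂ] Matrix n n ℂ :=
    (LinearMap.mulRight ℂ e) ∘ₗ (FreeAlgebra.lift ℂ X).toLinearMap
  let β : FreeAlgebra ℂ J →ₗ[ℂ] Matrix n n ℂ :=
    (LinearMap.mulRight ℂ f) ∘ₗ (FreeAlgebra.lift ℂ Y).toLinearMap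
  have hα : ∀ r, α r = FreeAlgebra.lift ℂ X r * e := fun r => rfl
  have hβ : ∀ r, β r = FreeAlgebra.lift ℂ Y r * f := fun r => rfl
  have hker : LinearMap.ker α ≤ LinearMap.ker β := by
    intro r hr
    rw [LinearMap.mem_ker] at hr ⊢
    obtain ⟨r', h1, h2⟩ := exists_lift_eq_conjTranspose hX hY r
    have h3 := htr (r' * r)
    rw [map_mul, map_mul, mul_assoc, ← hα, hr, mul_zero, trace_zero, h2] at h3
    rw [← trace_conjTranspose_mul_self_eq_zero_iff, hβ, conjTranspose_mul, hf.eq, mul_assoc,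
      trace_mul_comm, h3]
    simp only [mul_assoc, hff]
  obtain ⟨K', hK, hK'⟩ := isCompl_trace_orthogonal (LinearMap.range α)
  let φ : LinearMap.range α →ₗ[ℂ] Matrix n n ℂ :=
    (LinearMap.ker α).liftQ β hker ∘ₗ α.quotKerEquivRange.symm.toLinearMap
  have hφ : ∀ r, φ ⟨α r, LinearMap.mem_range_self α r⟩ = β r := fun r => by
    have : α.quotKerEquivRange.symm ⟨α r, LinearMap.mem_range_self α r⟩ =
        (LinearMap.ker α).mkQ r := LinearMap.quotKerEquivRange_symm_apply_image _ _ _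
    simp only [φ, LinearMap.comp_apply, LinearEquiv.coe_coe, this]
    rfl
  let Φ := φ ∘ₗ (LinearMap.range α).projectionOnto K' hK
  have h1 : ∀ r, Φ (α r) = β r := fun r => by
    rw [← hφ r]
    exact congrArg φ (Submodule.projectionOnto_apply_left hK ⟨α r, _⟩)
  have h2 : ∀ m ∈ K', Φ m = 0 := fun m hm => by
    simp only [Φ, LinearMap.comp_apply]
    rw [(Submodule.projectionOnto_apply_eq_zero_iff hK).mpr hm, map_zero]
  refine ⟨Φ, by simpa [hα, hβ] using h1 1, fun j m => ?_⟩
  obtain ⟨a, ⟨r, rfl⟩, b, hb, rfl⟩ : ∃ a ∈ LinearMap.range α, ∃ b ∈ K', a + b = m :=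
    Submodule.mem_sup.mp (hK.sup_eq_top ▸ Submodule.mem_top)
  have h3 : X j * α r = α (FreeAlgebra.ι ℂ j * r) := by simp [hα, mul_assoc]
  have h4 : Y j * β r = β (FreeAlgebra.ι ℂ j * r) := by simp [hβ, mul_assoc]
  have h5 : X j * b ∈ K' := by
    rw [hK'] at hb ⊢
    rintro _ ⟨s, rfl⟩
    have := hb (X j * α s) ⟨FreeAlgebra.ι ℂ j * s, by simp [hα, mul_assoc]⟩
    rwa [conjTranspose_mul, (hX j).eq, mul_assoc] at this
  rw [mul_add, map_add, map_add, h2 _ h5, h2 _ hb, h3, h1, h1, add_zero, add_zero, h4]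

/-- The columns of Φ give intertwiners T. If every compression f T e vanished, then f = f Φ(e) = 0,
so tr e = tr f = 0, forcing e = 0. -/
lemma exists_intertwiner (hX : ∀ j, (X j).IsHermitian) (hY : ∀ j, (Y j).IsHermitian)
    {e f : Matrix n n ℂ} (he : e.IsHermitian) (hf : f.IsHermitian) (hee : e * e = e)
    (hff : f * f = f) (heX : ∀ j, e * X j = X j * e) (hfY : ∀ j, f * Y j = Y j * f)
    (htr : ∀ r : FreeAlgebra ℂ J,
      (FreeAlgebra.lift ℂ X r * e).trace = (FreeAlgebra.lift ℂ Y r * f).trace) (he0 : e ≠ 0) :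
    ∃ S : Matrix n n ℂ, S ≠ 0 ∧ (∀ j, S * X j = Y j * S) ∧ f * S = S ∧ S * e = S := by
  obtain ⟨Φ, hΦe, hΦ⟩ := exists_linearMap_of_trace_eq hX hY hf hff htr
  choose T hT hTv using exists_intertwiner_of_linearMap Φ hΦ
  by_contra! hcon
  have h0 : ∀ l l', f * T l l' * e = 0 := fun l l' => by
    by_contra hne
    refine hcon (f * T l l' * e) hne (fun j => ?_) (by rw [← mul_assoc, ← mul_assoc, hff])
      (by rw [mul_assoc, hee])
    calc _ = f * (T l l' * X j) * e := by simp only [mul_assoc, heX]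
      _ = _ := by rw [hT, ← mul_assoc, hfY]; simp only [mul_assoc]
  have hff0 : f = 0 := by
    rw [← hff]
    nth_rewrite 2 [← hΦe]
    rw [sum_vecMulVec_mulVec_single e, map_sum, Finset.mul_sum]
    refine Finset.sum_eq_zero fun l _ => ext_of_mulVec_single fun l' => ?_
    have h := congrArg (· *ᵥ (Pi.single l 1 : n → ℂ)) (h0 l l')
    simp only [← mulVec_mulVec, hTv, zero_mulVec] at h
    rw [← mulVec_mulVec, h, zero_mulVec]
  have h1 : (eᴴ * e).trace = 0 := by
    have := htr 1
    rw [hff0] at this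
    rw [he.eq, hee]
    simpa using this
  exact he0 (trace_conjTranspose_mul_self_eq_zero_iff.mp h1)

/-- R is the polar part of S. It inherits the relations because its second factor is a polynomial in
Sᴴ * S, which commutes with each X j and with e. -/
lemma exists_partial_isometry (hX : ∀ j, (X j).IsHermitian) (hY : ∀ j, (Y j).IsHermitian)
    {e f S : Matrix n n ℂ} (he : e.IsHermitian)
    (hS : ∀ j, S * X j = Y j * S) (hS0 : S ≠ 0) (hfS : f * S = S) (hSe : S * e = S) :
    ∃ R : Matrix n n ℂ, R ≠ 0 ∧ R * Rᴴ * R = R ∧ (∀ j, R * X j = Y j * R) ∧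
      f * R = R ∧ R * e = R := by
  obtain ⟨p, h2, h3⟩ := exists_polynomial_partial_inv_sqrt S
  have hS' : ∀ j, Sᴴ * Y j = X j * Sᴴ := fun j => by
    have := congrArg conjTranspose (hS j)
    rw [conjTranspose_mul, conjTranspose_mul, (hX j).eq, (hY j).eq] at this
    exact this.symm
  have heS : e * Sᴴ = Sᴴ := by
    have := congrArg conjTranspose hSe
    rwa [conjTranspose_mul, he.eq] at this
  refine ⟨S * Polynomial.aeval (Sᴴ * S) p, fun h => hS0 (h3 h), h2, fun j => ?_, ?_, ?_⟩
  · have : X j * (Sᴴ * S) = (Sᴴ * S) * X j := by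
      rw [← mul_assoc, ← hS', mul_assoc, ← hS, mul_assoc]
    rw [mul_assoc, ← mul_aeval_of_intertwine this, ← mul_assoc, hS, mul_assoc]
  · rw [← mul_assoc, hfS]
  · have : e * (Sᴴ * S) = (Sᴴ * S) * e := by
      rw [← mul_assoc, heS, mul_assoc, hSe]
    rw [mul_assoc, ← mul_aeval_of_intertwine this, ← mul_assoc, hSe]

/-- **Specht's theorem** for families of Hermitian matrices. -/
theorem exists_unitary_conj_of_trace_eq (hX : ∀ j, (X j).IsHermitian)
    (hY : ∀ j, (Y j).IsHermitian)
    (h : ∀ w : List J, (w.map X).prod.trace = (w.map Y).prod.trace) :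
    ∃ V ∈ unitaryGroup n ℂ, ∀ j, V * X j * Vᴴ = Y j := by
  -- Among intertwining partial isometries, one with minimal kernel is unitary; otherwise a piece R
  -- between the complementary projections e and f can be added to it.
  let P : Set (Submodule ℂ (n → ℂ)) := {K | ∃ T : Matrix n n ℂ, T * Tᴴ * T = T ∧
    (∀ j, T * X j = Y j * T) ∧ K = LinearMap.ker T.mulVecLin}
  obtain ⟨K, ⟨T, hT, hTX, rfl⟩, hmin⟩ :=
    WellFounded.has_min (wellFounded_lt (α := Submodule ℂ (n → ℂ))) P
      ⟨_, 0, by simp, by simp, rfl⟩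
  have hTY : ∀ j, Tᴴ * Y j = X j * Tᴴ := fun j => by
    have := congrArg conjTranspose (hTX j)
    rw [conjTranspose_mul, conjTranspose_mul, (hX j).eq, (hY j).eq] at this
    exact this.symm
  have hT' : Tᴴ * T * Tᴴ = Tᴴ := by
    have := congrArg conjTranspose hT
    simpa [conjTranspose_mul, mul_assoc] using this
  set e := 1 - Tᴴ * T with he_def
  set f := 1 - T * Tᴴ with hf_def
  have he : e.IsHermitian := isHermitian_one.sub (isHermitian_conjTranspose_mul_self T)
  have hf : f.IsHermitian := isHermitian_one.sub (isHermitian_mul_conjTranspose_self T)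
  have hTe : T * e = 0 := by rw [he_def, mul_sub, mul_one, ← mul_assoc, hT, sub_self]
  have hTf : Tᴴ * f = 0 := by rw [hf_def, mul_sub, mul_one, ← mul_assoc, hT', sub_self]
  have hee : e * e = e := by
    nth_rewrite 1 [he_def]
    rw [sub_mul, one_mul, mul_assoc, hTe, mul_zero, sub_zero]
  have hff : f * f = f := by
    nth_rewrite 1 [hf_def]
    rw [sub_mul, one_mul, mul_assoc, hTf, mul_zero, sub_zero]
  by_cases he0 : e = 0
  · have h1 : Tᴴ * T = 1 := (sub_eq_zero.mp he0).symm
    have hU : T ∈ unitaryGroup n ℂ := mem_unitaryGroup_iff'.mpr h1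
    have h2 : T * Tᴴ = 1 := mem_unitaryGroup_iff.mp hU
    exact ⟨T, hU, fun j => by rw [hTX, mul_assoc, h2, mul_one]⟩
  exfalso
  have heX : ∀ j, e * X j = X j * e := fun j => by
    rw [he_def, sub_mul, mul_sub, mul_assoc, hTX, ← mul_assoc, hTY, mul_assoc, one_mul, mul_one]
  have hfY : ∀ j, f * Y j = Y j * f := fun j => by
    rw [hf_def, sub_mul, mul_sub, mul_assoc, hTY, ← mul_assoc, hTX, mul_assoc, one_mul, mul_one]
  -- The corners removed from both sides have equal trace: tr (Y(r) T Tᴴ) = tr (T X(r) Tᴴ) = tr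
  -- (X(r) Tᴴ T).
  have htr : ∀ r : FreeAlgebra ℂ J,
      (FreeAlgebra.lift ℂ X r * e).trace = (FreeAlgebra.lift ℂ Y r * f).trace := fun r => by
    rw [he_def, hf_def, mul_sub, mul_sub, trace_sub, trace_sub, mul_one, mul_one,
      trace_lift_eq h r, ← mul_assoc _ T, ← lift_intertwine hTX, ← mul_assoc,
      mul_assoc T, trace_mul_comm T]
  obtain ⟨S, hS0, hSX, hfS, hSe⟩ := exists_intertwiner hX hY he hf hee hff heX hfY htr he0
  obtain ⟨R, hR0, hRR, hRX, hfR, hRe⟩ := exists_partial_isometry hX hY he hSX hS0 hfS hSe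
  have hTR : Tᴴ * R = 0 := by rw [← hfR, ← mul_assoc, hTf, zero_mul]
  have hTR' : T * Rᴴ = 0 := by
    rw [← hRe, conjTranspose_mul, he.eq, ← mul_assoc, hTe, zero_mul]
  have hRT : R * Tᴴ = 0 := by
    have := congrArg conjTranspose hTR'
    simpa [conjTranspose_mul] using this
  have hRT' : Rᴴ * T = 0 := by
    have := congrArg conjTranspose hTR
    simpa [conjTranspose_mul] using this
  refine hmin (LinearMap.ker (T + R).mulVecLin) ⟨T + R, ?_, fun j => ?_, rfl⟩ ?_
  · rw [conjTranspose_add, add_mul, mul_add T, mul_add R, hTR', hRT, add_zero, zero_add, add_mul,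
      mul_add, mul_add, hT, hRR, mul_assoc, hTR, mul_assoc, hRT', mul_zero, mul_zero, add_zero,
      zero_add]
  · rw [add_mul, mul_add, hTX, hRX]
  · rw [SetLike.lt_iff_le_and_exists]
    constructor
    · intro v hv
      simp only [LinearMap.mem_ker, mulVecLin_apply] at hv ⊢
      have h1 := congrArg ((T * Tᴴ) *ᵥ ·) hv
      simpa [mulVec_mulVec, mul_add, hT, mul_assoc T Tᴴ R, hTR] using h1
    · by_contra! hc
      refine hR0 (ext_of_mulVec_single fun i => ?_)
      have h1 := hc (e *ᵥ Pi.single i 1) (by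
        rw [LinearMap.mem_ker, mulVecLin_apply, mulVec_mulVec, hTe, zero_mulVec])
      rwa [LinearMap.mem_ker, mulVecLin_apply, mulVec_mulVec, add_mul, hTe, hRe, zero_add,
        ← zero_mulVec (Pi.single i (1 : ℂ) : n → ℂ)] at h1

end Specht

end Matrix

namespace Matrix

/-! ### Expansion of words and cancellation of traces. -/

section Words

variable {n k ι : Type*} [Fintype n] [DecidableEq n] [Fintype k] [DecidableEq k]

/-- The family indexed by `ι × Bool` that interleaves two families. -/
def letter (X P : ι → Matrix n n ℂ) (l : ι × Bool) : Matrix n n ℂ :=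
  if l.2 then X l.1 else P l.1

lemma sum_map_mul_kronecker {α : Type*} (L : List α) (A : Matrix n n ℂ) (C : Matrix k k ℂ)
    (u : α → Matrix n n ℂ) (v : α → Matrix k k ℂ) :
    (A ⊗ₖ C) * (L.map fun p => u p ⊗ₖ v p).sum =
      (L.map fun p => (A * u p) ⊗ₖ (C * v p)).sum := by
  induction L with
  | nil => simp
  | cons p L ih => simp [mul_add, ih, mul_kronecker_mul]

/-- A word in the letters `X i ⊗ Q i + P i ⊗ Z i` and `P i ⊗ Q i` expands into the tensor product
of the word in the letters `X i`, `P i` with the word in the `Q i`, and terms whose first factors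
have fewer letters `X i`. -/
lemma exists_word_expansion (n k : Type*) [Fintype n] [DecidableEq n] [Fintype k] [DecidableEq k]
    (w : List (ι × Bool)) :
    ∃ L : List (List (ι × Bool) × List (ι × Bool)),
      (∀ p ∈ L, p.1.countP (·.2) < w.countP (·.2)) ∧
      ∀ (X P : ι → Matrix n n ℂ) (Z Q : ι → Matrix k k ℂ),
        (w.map (letter (fun i => X i ⊗ₖ Q i + P i ⊗ₖ Z i) fun i => P i ⊗ₖ Q i)).prod =
          (w.map (letter X P)).prod ⊗ₖ (w.map fun l => Q l.1).prod +
          (L.map fun p => (p.1.map (letter X P)).prod ⊗ₖ (p.2.map (letter Z Q)).prod).sum := by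
  induction w with
  | nil => exact ⟨[], by simp, by simp⟩
  | cons l w ih =>
    obtain ⟨L, hL, h⟩ := ih
    obtain ⟨i, b⟩ := l
    cases b with
    | false =>
      refine ⟨L.map fun p => ((i, false) :: p.1, (i, false) :: p.2), ?_, fun X P Z Q => ?_⟩
      · intro p hp
        obtain ⟨q, hq, rfl⟩ := List.mem_map.mp hp
        simpa using hL q hq
      · rw [List.map_cons, List.prod_cons, h]
        simp [letter, mul_add, sum_map_mul_kronecker, mul_kronecker_mul, Function.comp_def]
    | true =>
      -- The three groups are X ⊗ Q times a lower term, P ⊗ Z times the leading term, and P ⊗ Z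
      -- times a lower term.
      refine ⟨(L.map fun p => ((i, true) :: p.1, (i, false) :: p.2)) ++
        ((i, false) :: w, (i, true) :: w.map fun l => (l.1, false)) ::
        (L.map fun p => ((i, false) :: p.1, (i, true) :: p.2)), ?_, fun X P Z Q => ?_⟩
      · intro p hp
        simp only [List.mem_append, List.mem_cons, List.mem_map] at hp
        rcases hp with ⟨q, hq, rfl⟩ | rfl | ⟨q, hq, rfl⟩
        · simpa using hL q hq
        · simp
        · simpa using (hL q hq).le.trans_lt (Nat.lt_succ_self _)
      · rw [List.map_cons, List.prod_cons, h]
        simp [letter, mul_add, add_mul, sum_map_mul_kronecker, mul_kronecker_mul,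
          Function.comp_def]
        abel

lemma trace_list_sum_map {α : Type*} (L : List α) (f : α → Matrix n n ℂ) :
    (L.map f).sum.trace = (L.map fun p => (f p).trace).sum := by
  induction L with
  | nil => simp
  | cons p L ih => simp [ih]

/-- The second tensor factors are the same on both sides, so by induction the lower terms have equal
traces, leaving the leading terms with the common factor given by the nonzero trace of a Q-word. -/
lemma trace_word_cancel {X P X' P' : ι → Matrix n n ℂ} {Z Q : ι → Matrix k k ℂ}
    (hQ : ∀ w : List ι, (w.map Q).prod.trace ≠ 0)
    (h : ∀ w : List (ι × Bool),
      (w.map (letter (fun i => X i ⊗ₖ Q i + P i ⊗ₖ Z i) fun i => P i ⊗ₖ Q i)).prod.trace =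
      (w.map (letter (fun i => X' i ⊗ₖ Q i + P' i ⊗ₖ Z i) fun i => P' i ⊗ₖ Q i)).prod.trace)
    (w : List (ι × Bool)) :
    (w.map (letter X P)).prod.trace = (w.map (letter X' P')).prod.trace := by
  induction hd : w.countP (·.2) using Nat.strong_induction_on generalizing w with
  | _ d ih =>
    obtain ⟨L, hL, he⟩ := exists_word_expansion n k w
    have hw := h w
    have hsum : (L.map fun p => ((p.1.map (letter X P)).prod ⊗ₖ
          (p.2.map (letter Z Q)).prod).trace).sum =
        (L.map fun p => ((p.1.map (letter X' P')).prod ⊗ₖ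
          (p.2.map (letter Z Q)).prod).trace).sum := by
      congr 1
      refine List.map_congr_left fun p hp => ?_
      rw [trace_kronecker, trace_kronecker, ih _ (hd ▸ hL p hp) p.1 rfl]
    rw [he, he, trace_add, trace_add, trace_list_sum_map, trace_list_sum_map, hsum,
      add_left_inj, trace_kronecker, trace_kronecker] at hw
    refine mul_right_cancel₀ ?_ hw
    simpa [List.map_map, Function.comp_def] using hQ (w.map Prod.fst)

lemma trace_word_eq_of_unitary_conj {J : Type*} {U : Matrix n n ℂ} (hU : U ∈ unitaryGroup n ℂ)
    {X Y : J → Matrix n n ℂ} (h : ∀ j, U * X j * Uᴴ = Y j) (w : List J) :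
    (w.map X).prod.trace = (w.map Y).prod.trace := by
  have h1 : Uᴴ * U = 1 := mem_unitaryGroup_iff'.mp hU
  have h2 : U * Uᴴ = 1 := mem_unitaryGroup_iff.mp hU
  have key : (w.map Y).prod = U * (w.map X).prod * Uᴴ := by
    induction w with
    | nil => simp [h2]
    | cons j w ih => rw [List.map_cons, List.map_cons, List.prod_cons, List.prod_cons, ih, ← h,
        unitary_conj_mul hU]
  rw [key, trace_mul_comm, ← mul_assoc, h1, one_mul]

end Words

end Matrix

namespace Matrix

/-! ### Logarithms and support projections of positive semidefinite matrices. -/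

section Logarithm

variable {n k : Type*} [Fintype n] [DecidableEq n] [Fintype k] [DecidableEq k]

/-- The indicator function of the nonzero reals. -/
noncomputable def nonzeroIndicator (x : ℝ) : ℝ := if x = 0 then 0 else 1

/-- The convention `Real.log 0 = 0` extends additivity to zero arguments, with supports in place of
1. -/
lemma log_mul_eq (x y : ℝ) : Real.log (x * y) =
    Real.log x * nonzeroIndicator y + nonzeroIndicator x * Real.log y := by
  by_cases hx : x = 0
  · simp [hx, nonzeroIndicator]
  by_cases hy : y = 0
  · simp [hy, nonzeroIndicator]
  simp [hx, hy, nonzeroIndicator, Real.log_mul]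

lemma nonzeroIndicator_mul (x y : ℝ) :
    nonzeroIndicator (x * y) = nonzeroIndicator x * nonzeroIndicator y := by
  by_cases hx : x = 0 <;> by_cases hy : y = 0 <;> simp [hx, hy, nonzeroIndicator]

lemma IsHermitian.cfc_eq_conj {A : Matrix n n ℂ} (hA : A.IsHermitian) (f : ℝ → ℝ) :
    hA.cfc f = (hA.eigenvectorUnitary : Matrix n n ℂ) *
      diagonal (fun i => (f (hA.eigenvalues i) : ℂ)) *
      (hA.eigenvectorUnitary : Matrix n n ℂ)ᴴ := rfl

lemma IsHermitian.isHermitian_cfc {A : Matrix n n ℂ} (hA : A.IsHermitian) (f : ℝ → ℝ) :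
    (hA.cfc f).IsHermitian := by
  rw [hA.cfc_eq_conj]
  refine isHermitian_mul_mul_conjTranspose _ ?_
  rw [isHermitian_diagonal_iff]
  intro i
  simp [IsSelfAdjoint]

lemma IsHermitian.cfc_mul_cfc {A : Matrix n n ℂ} (hA : A.IsHermitian) (f g : ℝ → ℝ) :
    hA.cfc f * hA.cfc g = hA.cfc fun x => f x * g x := by
  simp only [hA.cfc_eq_conj]
  rw [unitary_conj_mul hA.eigenvectorUnitary.2, diagonal_mul_diagonal]
  simp

/-- Using polynomials and the product eigenbasis avoids comparison with the spectral data chosen for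
A ⊗ C itself. -/
lemma IsHermitian.kronecker_aeval {A : Matrix n n ℂ} {C : Matrix k k ℂ} (hA : A.IsHermitian)
    (hC : C.IsHermitian) (p : Polynomial ℂ) :
    Polynomial.aeval (A ⊗ₖ C) p =
      ((hA.eigenvectorUnitary : Matrix n n ℂ) ⊗ₖ (hC.eigenvectorUnitary : Matrix k k ℂ)) *
      diagonal (fun i : n × k => p.eval ((hA.eigenvalues i.1 * hC.eigenvalues i.2 : ℝ) : ℂ)) *
      ((hA.eigenvectorUnitary : Matrix n n ℂ) ⊗ₖ (hC.eigenvectorUnitary : Matrix k k ℂ))ᴴ := by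
  have hU : (hA.eigenvectorUnitary : Matrix n n ℂ) ⊗ₖ (hC.eigenvectorUnitary : Matrix k k ℂ) ∈
      unitaryGroup (n × k) ℂ :=
    kronecker_mem_unitary hA.eigenvectorUnitary.2 hC.eigenvectorUnitary.2
  have h : A ⊗ₖ C =
      ((hA.eigenvectorUnitary : Matrix n n ℂ) ⊗ₖ (hC.eigenvectorUnitary : Matrix k k ℂ)) *
      diagonal (fun i : n × k => ((hA.eigenvalues i.1 * hC.eigenvalues i.2 : ℝ) : ℂ)) *
      ((hA.eigenvectorUnitary : Matrix n n ℂ) ⊗ₖ (hC.eigenvectorUnitary : Matrix k k ℂ))ᴴ := by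
    have h1 : A = (hA.eigenvectorUnitary : Matrix n n ℂ) *
      diagonal (fun i => (hA.eigenvalues i : ℂ)) * (hA.eigenvectorUnitary : Matrix n n ℂ)ᴴ :=
      hA.spectral_theorem
    have h2 : C = (hC.eigenvectorUnitary : Matrix k k ℂ) *
      diagonal (fun i => (hC.eigenvalues i : ℂ)) * (hC.eigenvectorUnitary : Matrix k k ℂ)ᴴ :=
      hC.spectral_theorem
    conv_lhs => rw [h1, h2]
    rw [mul_kronecker_mul, mul_kronecker_mul, diagonal_kronecker_diagonal, conjTranspose_kronecker]
    simp
  rw [← aeval_diagonal, ← aeval_unitary_conj hU, ← h]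

lemma IsHermitian.cfc_kronecker_cfc {A : Matrix n n ℂ} {C : Matrix k k ℂ} (hA : A.IsHermitian)
    (hC : C.IsHermitian) (f g : ℝ → ℝ) :
    hA.cfc f ⊗ₖ hC.cfc g =
      ((hA.eigenvectorUnitary : Matrix n n ℂ) ⊗ₖ (hC.eigenvectorUnitary : Matrix k k ℂ)) *
      diagonal (fun i : n × k => ((f (hA.eigenvalues i.1) * g (hC.eigenvalues i.2) : ℝ) : ℂ)) *
      ((hA.eigenvectorUnitary : Matrix n n ℂ) ⊗ₖ (hC.eigenvectorUnitary : Matrix k k ℂ))ᴴ := by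
  rw [hA.cfc_eq_conj, hC.cfc_eq_conj, mul_kronecker_mul, mul_kronecker_mul,
    diagonal_kronecker_diagonal, conjTranspose_kronecker]
  simp

lemma IsHermitian.aeval_kronecker_eq_cfc_log {A : Matrix n n ℂ} {C : Matrix k k ℂ}
    (hA : A.IsHermitian) (hC : C.IsHermitian) (p : Polynomial ℂ)
    (hp : ∀ i j, p.eval ((hA.eigenvalues i * hC.eigenvalues j : ℝ) : ℂ) =
      (Real.log (hA.eigenvalues i * hC.eigenvalues j) : ℂ)) :
    Polynomial.aeval (A ⊗ₖ C) p = hA.cfc Real.log ⊗ₖ hC.cfc nonzeroIndicator +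
      hA.cfc nonzeroIndicator ⊗ₖ hC.cfc Real.log := by
  rw [hA.kronecker_aeval hC, hA.cfc_kronecker_cfc, hA.cfc_kronecker_cfc, ← add_mul, ← mul_add,
    diagonal_add]
  simp only [hp, log_mul_eq, Complex.ofReal_add]

lemma IsHermitian.aeval_kronecker_eq_cfc_nonzeroIndicator {A : Matrix n n ℂ} {C : Matrix k k ℂ}
    (hA : A.IsHermitian) (hC : C.IsHermitian) (p : Polynomial ℂ)
    (hp : ∀ i j, p.eval ((hA.eigenvalues i * hC.eigenvalues j : ℝ) : ℂ) =
      (nonzeroIndicator (hA.eigenvalues i * hC.eigenvalues j) : ℂ)) :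
    Polynomial.aeval (A ⊗ₖ C) p = hA.cfc nonzeroIndicator ⊗ₖ hC.cfc nonzeroIndicator := by
  rw [hA.kronecker_aeval hC, hA.cfc_kronecker_cfc]
  simp only [hp, nonzeroIndicator_mul]

/-- Simultaneous interpolation on the products of eigenvalues. -/
lemma exists_polynomial_eval_mul (a b : n → ℝ) (c : k → ℝ) (g : ℝ → ℝ) :
    ∃ p : Polynomial ℂ, (∀ i j, p.eval ((a i * c j : ℝ) : ℂ) = (g (a i * c j) : ℂ)) ∧
      ∀ i j, p.eval ((b i * c j : ℝ) : ℂ) = (g (b i * c j) : ℂ) := by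
  obtain ⟨p, hp⟩ := exists_polynomial_eval_eq
    ((Finset.univ.image fun i : n × k => ((a i.1 * c i.2 : ℝ) : ℂ)) ∪
      Finset.univ.image fun i : n × k => ((b i.1 * c i.2 : ℝ) : ℂ)) fun x => (g x.re : ℂ)
  refine ⟨p, fun i j => ?_, fun i j => ?_⟩
  · rw [hp _ (Finset.mem_union_left _ (Finset.mem_image_of_mem _ (Finset.mem_univ (i, j)))),
      Complex.ofReal_re]
  · rw [hp _ (Finset.mem_union_right _ (Finset.mem_image_of_mem _ (Finset.mem_univ (i, j)))),
      Complex.ofReal_re]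

/-- The logarithm cannot tell eigenvalue 0 from eigenvalue 1; the support projection restores the
difference. -/
lemma PosSemidef.eq_nonzeroIndicator_mul_aeval_log {A : Matrix n n ℂ} (hA : A.PosSemidef)
    (p : Polynomial ℂ)
    (hp : ∀ i, p.eval (Real.log (hA.1.eigenvalues i) : ℂ) =
      (Real.exp (Real.log (hA.1.eigenvalues i)) : ℂ)) :
    A = hA.1.cfc nonzeroIndicator * Polynomial.aeval (hA.1.cfc Real.log) p := by
  rw [hA.1.cfc_eq_conj, hA.1.cfc_eq_conj, aeval_unitary_conj hA.1.eigenvectorUnitary.2,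
    aeval_diagonal, unitary_conj_mul hA.1.eigenvectorUnitary.2, diagonal_mul_diagonal]
  refine hA.1.spectral_theorem.trans ?_
  rw [Unitary.conjStarAlgAut_apply]
  simp only [hp]
  congr 3
  ext i
  rcases (hA.eigenvalues_nonneg i).eq_or_lt with h | h
  · simp [← h, nonzeroIndicator]
  · rw [Real.exp_log h]
    simp [nonzeroIndicator, h.ne']

lemma exists_polynomial_log (a b : n → ℝ) :
    ∃ p : Polynomial ℂ,
      (∀ i, p.eval (Real.log (a i) : ℂ) = (Real.exp (Real.log (a i)) : ℂ)) ∧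
      ∀ i, p.eval (Real.log (b i) : ℂ) = (Real.exp (Real.log (b i)) : ℂ) := by
  obtain ⟨p, hp⟩ := exists_polynomial_eval_eq
    ((Finset.univ.image fun i : n => (Real.log (a i) : ℂ)) ∪
      Finset.univ.image fun i : n => (Real.log (b i) : ℂ)) fun x => (Real.exp x.re : ℂ)
  refine ⟨p, fun i => ?_, fun i => ?_⟩
  · rw [hp _ (Finset.mem_union_left _ (Finset.mem_image_of_mem _ (Finset.mem_univ i))),
      Complex.ofReal_re]
  · rw [hp _ (Finset.mem_union_right _ (Finset.mem_image_of_mem _ (Finset.mem_univ i))),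
      Complex.ofReal_re]

lemma PosSemidef.isIdempotentElem_nonzeroIndicator {C : Matrix k k ℂ} (hC : C.PosSemidef) :
    IsIdempotentElem (hC.1.cfc nonzeroIndicator) := by
  rw [IsIdempotentElem, hC.1.cfc_mul_cfc]
  congr 1
  ext x
  by_cases hx : x = 0 <;> simp [nonzeroIndicator, hx]

lemma PosSemidef.nonzeroIndicator_mul_self {C : Matrix k k ℂ} (hC : C.PosSemidef) :
    hC.1.cfc nonzeroIndicator * C = C := by
  obtain ⟨p, hp, -⟩ := exists_polynomial_log hC.1.eigenvalues hC.1.eigenvalues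
  have h := hC.eq_nonzeroIndicator_mul_aeval_log p hp
  calc hC.1.cfc nonzeroIndicator * C
      = hC.1.cfc nonzeroIndicator *
        (hC.1.cfc nonzeroIndicator * Polynomial.aeval (hC.1.cfc Real.log) p) := congrArg _ h
    _ = C := by rw [← mul_assoc, hC.isIdempotentElem_nonzeroIndicator.eq, ← h]

lemma PosSemidef.trace_nonzeroIndicator_ne_zero {C : Matrix k k ℂ} (hC : C.PosSemidef)
    (h0 : C ≠ 0) : (hC.1.cfc nonzeroIndicator).trace ≠ 0 := by
  intro h
  have hi : (hC.1.cfc nonzeroIndicator)ᴴ * hC.1.cfc nonzeroIndicator =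
      hC.1.cfc nonzeroIndicator := by
    rw [(hC.1.isHermitian_cfc _).eq, hC.isIdempotentElem_nonzeroIndicator.eq]
  rw [← hi, trace_conjTranspose_mul_self_eq_zero_iff] at h
  exact h0 (by rw [← hC.nonzeroIndicator_mul_self, h, zero_mul])

lemma PosSemidef.nonzeroIndicator_eq_one {C : Matrix k k ℂ} (hC : C.PosSemidef)
    (hu : IsUnit C) : hC.1.cfc nonzeroIndicator = 1 :=
  hu.mul_right_cancel (by rw [hC.nonzeroIndicator_mul_self, one_mul])

end Logarithm

/-! ### Positive semidefinite factors, rescaling and conclusion. -/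

section Main

variable {n k ι : Type*} [Fintype n] [DecidableEq n] [Fintype k] [DecidableEq k]

/-- With a single nontrivial idempotent, every word collapses to 1 or to that idempotent; two
singular indices could give a traceless product. -/
lemma trace_list_prod_ne_zero {Q : ι → Matrix k k ℂ} (i₀ : ι) (h1 : ∀ i, i ≠ i₀ → Q i = 1)
    (hQ : IsIdempotentElem (Q i₀)) (h0 : (Q i₀).trace ≠ 0) (w : List ι) :
    (w.map Q).prod.trace ≠ 0 := by
  have key : (w.map Q).prod = 1 ∨ (w.map Q).prod = Q i₀ := by
    induction w with
    | nil => simp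
    | cons i w ih =>
      rw [List.map_cons, List.prod_cons]
      by_cases hi : i = i₀
      · subst hi
        rcases ih with h | h <;> simp [h, hQ.eq]
      · rwa [h1 i hi, one_mul]
  rcases key with h | h
  · rw [h, trace_one]
    have : Nonempty k := by
      by_contra hk
      rw [not_nonempty_iff] at hk
      exact h0 (by simp [trace])
    exact_mod_cast Fintype.card_ne_zero
  · rwa [h]

theorem exists_unitary_conj_of_kronecker_posSemidef (A B : ι → Matrix n n ℂ)
    (C : ι → Matrix k k ℂ) (hA : ∀ i, (A i).PosSemidef) (hB : ∀ i, (B i).PosSemidef)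
    (hC : ∀ i, (C i).PosSemidef) (i₀ : ι) (hC₀ : C i₀ ≠ 0) (hCu : ∀ i, i ≠ i₀ → IsUnit (C i))
    {U : Matrix (n × k) (n × k) ℂ} (hU : U ∈ unitaryGroup (n × k) ℂ)
    (h : ∀ i, U * (A i ⊗ₖ C i) * Uᴴ = B i ⊗ₖ C i) :
    ∃ V ∈ unitaryGroup n ℂ, ∀ i, V * A i * Vᴴ = B i := by
  have hlog : ∀ i, U * ((hA i).1.cfc Real.log ⊗ₖ (hC i).1.cfc nonzeroIndicator +
      (hA i).1.cfc nonzeroIndicator ⊗ₖ (hC i).1.cfc Real.log) * Uᴴ =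
      (hB i).1.cfc Real.log ⊗ₖ (hC i).1.cfc nonzeroIndicator +
      (hB i).1.cfc nonzeroIndicator ⊗ₖ (hC i).1.cfc Real.log := fun i => by
    -- One polynomial interpolates on both spectra, so conjugation by U passes through it.
    obtain ⟨p, h1, h2⟩ := exists_polynomial_eval_mul (hA i).1.eigenvalues (hB i).1.eigenvalues
      (hC i).1.eigenvalues Real.log
    rw [← (hA i).1.aeval_kronecker_eq_cfc_log (hC i).1 p h1,
      ← (hB i).1.aeval_kronecker_eq_cfc_log (hC i).1 p h2, ← aeval_unitary_conj hU, h]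
  have hind : ∀ i, U * ((hA i).1.cfc nonzeroIndicator ⊗ₖ (hC i).1.cfc nonzeroIndicator) * Uᴴ =
      (hB i).1.cfc nonzeroIndicator ⊗ₖ (hC i).1.cfc nonzeroIndicator := fun i => by
    obtain ⟨p, h1, h2⟩ := exists_polynomial_eval_mul (hA i).1.eigenvalues (hB i).1.eigenvalues
      (hC i).1.eigenvalues nonzeroIndicator
    rw [← (hA i).1.aeval_kronecker_eq_cfc_nonzeroIndicator (hC i).1 p h1,
      ← (hB i).1.aeval_kronecker_eq_cfc_nonzeroIndicator (hC i).1 p h2, ← aeval_unitary_conj hU, h]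
  have htr := trace_word_cancel (X := fun i => (hA i).1.cfc Real.log)
    (P := fun i => (hA i).1.cfc nonzeroIndicator) (X' := fun i => (hB i).1.cfc Real.log)
    (P' := fun i => (hB i).1.cfc nonzeroIndicator) (Z := fun i => (hC i).1.cfc Real.log)
    (Q := fun i => (hC i).1.cfc nonzeroIndicator)
    (trace_list_prod_ne_zero i₀ (fun i hi => (hC i).nonzeroIndicator_eq_one (hCu i hi))
      (hC i₀).isIdempotentElem_nonzeroIndicator ((hC i₀).trace_nonzeroIndicator_ne_zero hC₀))
    (trace_word_eq_of_unitary_conj hU (by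
      rintro ⟨i, b⟩
      cases b
      · simpa [letter] using hind i
      · simpa [letter] using hlog i))
  obtain ⟨V, hV, hVc⟩ := exists_unitary_conj_of_trace_eq (fun l => by
      unfold letter; split_ifs <;> exact IsHermitian.isHermitian_cfc _ _) (fun l => by
      unfold letter; split_ifs <;> exact IsHermitian.isHermitian_cfc _ _) htr
  refine ⟨V, hV, fun i => ?_⟩
  have hX : V * (hA i).1.cfc Real.log * Vᴴ = (hB i).1.cfc Real.log := by
    simpa [letter] using hVc (i, true)
  have hP : V * (hA i).1.cfc nonzeroIndicator * Vᴴ = (hB i).1.cfc nonzeroIndicator := by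
    simpa [letter] using hVc (i, false)
  obtain ⟨p, h1, h2⟩ := exists_polynomial_log (hA i).1.eigenvalues (hB i).1.eigenvalues
  rw [(hB i).eq_nonzeroIndicator_mul_aeval_log p h2, ← hX, ← hP, aeval_unitary_conj hV,
    unitary_conj_mul hV, ← (hA i).eq_nonzeroIndicator_mul_aeval_log p h1]

/-- A partial trace is a sum of principal submatrices. -/
lemma PosSemidef.trace_smul_left {A : Matrix n n ℂ} {C : Matrix k k ℂ}
    (h : (A ⊗ₖ C).PosSemidef) : (C.trace • A).PosSemidef := by
  have : C.trace • A = ∑ j, (A ⊗ₖ C).submatrix (fun i => (i, j)) (fun i => (i, j)) := by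
    ext a b
    simp [sum_apply, trace, ← Finset.mul_sum, mul_comm]
  rw [this]
  exact posSemidef_sum _ fun j _ => h.submatrix _

lemma PosSemidef.trace_smul_right {A : Matrix n n ℂ} {C : Matrix k k ℂ}
    (h : (A ⊗ₖ C).PosSemidef) : (A.trace • C).PosSemidef := by
  have : A.trace • C = ∑ j, (A ⊗ₖ C).submatrix (fun i => (j, i)) (fun i => (j, i)) := by
    ext a b
    simp [sum_apply, trace, Finset.sum_mul]
  rw [this]
  exact posSemidef_sum _ fun j _ => h.submatrix _

lemma kronecker_eq_zero_iff {A : Matrix n n ℂ} {C : Matrix k k ℂ} :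
    A ⊗ₖ C = 0 ↔ A = 0 ∨ C = 0 := by
  constructor
  · intro h
    by_contra! hne
    obtain ⟨hA, hC⟩ := hne
    obtain ⟨i, j, hij⟩ : ∃ i j, A i j ≠ 0 := by
      by_contra! h'
      exact hA (ext h')
    refine hC (ext fun a b => ?_)
    have := congrFun (congrFun h (i, a)) (j, b)
    rw [kronecker_apply, zero_apply] at this
    exact (mul_eq_zero.mp this).resolve_left hij
  · rintro (rfl | rfl) <;> simp

/-- The factors of positive semidefinite Kronecker products with a common second factor can be
rescaled to be positive semidefinite. -/
lemma exists_posSemidef_factors {A B : Matrix n n ℂ} {C : Matrix k k ℂ} (hC : C ≠ 0)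
    (hA : (A ⊗ₖ C).PosSemidef) (hB : (B ⊗ₖ C).PosSemidef) {U : Matrix (n × k) (n × k) ℂ}
    (h : U * (A ⊗ₖ C) * Uᴴ = B ⊗ₖ C) :
    ∃ (z : ℂ) (D : Matrix k k ℂ), z ≠ 0 ∧ D ≠ 0 ∧ (IsUnit C → IsUnit D) ∧
      (z • A).PosSemidef ∧ (z • B).PosSemidef ∧ D.PosSemidef ∧
      U * ((z • A) ⊗ₖ D) * Uᴴ = (z • B) ⊗ₖ D := by
  by_cases hA0 : A = 0
  · have hB0 : B = 0 := by
      rw [hA0, zero_kronecker, mul_zero, zero_mul] at h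
      exact (kronecker_eq_zero_iff.mp h.symm).resolve_right hC
    have hk : Nonempty k := by
      by_contra hk
      rw [not_nonempty_iff] at hk
      exact hC (Subsingleton.elim _ _)
    -- With A = B = 0 the second factor carries no information, so the identity can replace C.
    exact ⟨1, 1, one_ne_zero, one_ne_zero, fun _ => isUnit_one, by simp [hA0, PosSemidef.zero],
      by simp [hB0, PosSemidef.zero], PosSemidef.one, by simp [hA0, hB0]⟩
  · have htr : A.trace * C.trace ≠ 0 := by
      rw [← trace_kronecker, Ne, hA.trace_eq_zero_iff, kronecker_eq_zero_iff]
      tauto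
    have htr0 : 0 ≤ A.trace * C.trace := by
      rw [← trace_kronecker]
      exact hA.trace_nonneg
    have hz : C.trace ≠ 0 := right_ne_zero_of_mul htr
    refine ⟨C.trace, C.trace⁻¹ • C, hz, smul_ne_zero (inv_ne_zero hz) hC, fun hu => ?_,
      hA.trace_smul_left, hB.trace_smul_left, ?_, ?_⟩
    · exact hu.smul (Units.mk0 _ (inv_ne_zero hz))
    -- The possibly non-real scalar is absorbed: tr A · C is a partial trace and tr A · tr C is a
    -- positive number.
    · have : C.trace⁻¹ • C = (A.trace * C.trace)⁻¹ • (A.trace • C) := by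
        rw [smul_smul]
        congr 1
        have := left_ne_zero_of_mul htr
        field_simp
      rw [this]
      exact hA.trace_smul_right.smul (inv_nonneg.mpr htr0)
    · rw [smul_kronecker, smul_kronecker, kronecker_smul, kronecker_smul, smul_smul, smul_smul,
        mul_inv_cancel₀ hz, one_smul, one_smul, h]

lemma isUnit_of_rank_eq_card {M : Matrix n n ℂ} (h : M.rank = Fintype.card n) : IsUnit M := by
  rw [← mulVec_surjective_iff_isUnit]
  have : LinearMap.range M.mulVecLin = ⊤ := by
    apply Submodule.eq_top_of_finrank_eq
    rw [Module.finrank_fintype_fun_eq_card]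
    exact h
  exact LinearMap.range_eq_top.mp this

lemma isUnit_right_of_kronecker [Nonempty n] {A : Matrix n n ℂ} {C : Matrix k k ℂ}
    (h : IsUnit (A ⊗ₖ C)) : IsUnit C := by
  rw [isUnit_iff_isUnit_det, det_kronecker, isUnit_iff_ne_zero] at h
  rw [isUnit_iff_isUnit_det, isUnit_iff_ne_zero]
  exact fun h0 => right_ne_zero_of_mul h (by rw [h0, zero_pow Fintype.card_ne_zero])

end Main

end Matrix

theorem mainTheorem2 {m : ℕ} {n k : Type*} [Fintype n] [DecidableEq n] [Fintype k] [DecidableEq k]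
    (A B : Fin (m + 1) → Matrix n n ℂ) (C : Fin (m + 1) → Matrix k k ℂ)
    (hA : ∀ i, (A i ⊗ₖ C i).PosSemidef)
    (hB : ∀ i, (B i ⊗ₖ C i).PosSemidef)
    (hA_rank : ∀ i, i ≠ 0 → (A i ⊗ₖ C i).rank = Fintype.card (n × k))
    (hB_rank : ∀ i, i ≠ 0 → (B i ⊗ₖ C i).rank = Fintype.card (n × k))
    (hC : C 0 ≠ 0)
    (hU : ∃ U ∈ Matrix.unitaryGroup (n × k) ℂ, ∀ i, U * (A i ⊗ₖ C i) * Uᴴ = B i ⊗ₖ C i) :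
    ∃ V ∈ Matrix.unitaryGroup n ℂ, ∀ i, V * A i * Vᴴ = B i := by
  obtain ⟨U, hU, h⟩ := hU
  rcases isEmpty_or_nonempty n with hn | hn
  · exact ⟨1, one_mem _, fun i => Subsingleton.elim _ _⟩
  have hk : Nonempty k := by
    by_contra hk
    rw [not_nonempty_iff] at hk
    exact hC (Subsingleton.elim _ _)
  have hCu : ∀ i, i ≠ 0 → IsUnit (C i) := fun i hi =>
    Matrix.isUnit_right_of_kronecker (Matrix.isUnit_of_rank_eq_card (hA_rank i hi))
  have hC0 : ∀ i, C i ≠ 0 := fun i => by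
    by_cases hi : i = 0
    · rwa [hi]
    · exact (hCu i hi).ne_zero
  choose z D hz hD hDu hzA hzB hDpos hzU using fun i =>
    Matrix.exists_posSemidef_factors (hC0 i) (hA i) (hB i) (h i)
  obtain ⟨V, hV, hVc⟩ := Matrix.exists_unitary_conj_of_kronecker_posSemidef _ _ D hzA hzB hDpos 0
    (hD 0) (fun i hi => hDu i (hCu i hi)) hU hzU
  refine ⟨V, hV, fun i => ?_⟩
  -- V conjugates the rescaled factors; the same nonzero scalar z i cancels on both sides.
  have := hVc i
  rw [mul_smul_comm, smul_mul_assoc] at this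
  exact smul_right_injective _ (hz i) this
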